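/- **Theorem 15 (Generalized Separation Principle).** Consider the real linear system $\dot x=Ax+Bu$, $y=Cx$, with $x(t)\in\mathbb R^n$, $u(t)\in\mathbb R^m$, $y(t)\in\mathbb R^p$, and the functional $z=Fx$ with $F\in\mathbb R^{r\times n}$. Let $R_1\in\mathbb R^{s_1\times n}$ and $R_2\in\mathbb R^{s_2\times n}$ be matrices, possibly empty ($s_1,s_2\ge 0$). Put $S_1=\begin{pmatrix}F\\R_1\end{pmatrix}$, $S=\begin{pmatrix}S_1\\R_2\end{pmatrix}$, $q_1=r+s_1$, $q=r+s_1+s_2$, and suppose that $$\operatorname{rank}\begin{pmatrix}SA\\CA\\C\\S\end{pmatrix}=\operatorname{rank}\begin{pmatrix}CA\\C\\S\end{pmatrix},\qquad \operatorname{rank}\begin{pmatrix}\lambda S-SA\\CA\\C\end{pmatrix}=\operatorname{rank}\begin{pmatrix}CA\\C\\S\end{pmatrix}\quad\forall\lambda\in\mathbb C,$$ $$\operatorname{rank}\begin{pmatrix}S_1A\\S_1\end{pmatrix}=\operatorname{rank}S_1,\qquad \operatorname{rank}\begin{pmatrix}\lambda S_1-S_1A&S_1B\end{pmatrix}=\operatorname{rank}S_1\quad\forall\lambda\in\mathbb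 C.$$ An *observer of order $q$* consists of matrices $N,J,H,E$ such that, for every input $u$, every solution $x$ of the system and every solution $w$ of $\dot w=Nw+Jy+Hu$, the error $\varepsilon=Sx-(w+Ey)$ satisfies $\dot\varepsilon=N\varepsilon$. Write $w+Ey=(\hat z;\hat z_{R_1};\hat z_{R_2})$ and $z_{R_1}=R_1x$; the *controller* with gain $Z\in\mathbb R^{m\times q_1}$ is $u=-Z\begin{pmatrix}\hat z\\\hat z_{R_1}\end{pmatrix}$. A generalized inverse $S_1^-$ is any matrix with $S_1S_1^-S_1=S_1$. Then the following hold. 1. (Controller design.) If the rows of $S_1$ are linearly independent, then for every $S_1^-$ and every monic real polynomial $f$ of degree $q_1$ there is a gain $Z$ such that $S_1AS_1^--S_1BZ$ has characteristic polynomial $f$. 2. (Observer design.) For every monic real polynomial $g$ of degree $q$ there is an observer of order $q$ such that $N$ has characteristic polynomial $g$. 3. (Closed loop.) For every gain $Z$ and every observer of order $q$, the closed loop has a solution for all initial values of $x$ and $w$, and for every $S_1^-$ all its solutions satisfy $$\frac{d}{dt}\begin{pmatrix}z\\z_{R_1}\\\varepsilon\end{pmatrix}=\Psi\begin{pmatrix}z\\z_{R_1}\\\varepsilon\end{pmatrix},\qquad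 \Psi=\begin{pmatrix}S_1AS_1^--S_1BZ&S_1BZ\begin{pmatrix}I_{q_1}&0\end{pmatrix}\\0&N\end{pmatrix},$$ and the characteristic polynomial of $\Psi$ is the product of those of $S_1AS_1^--S_1BZ$ and $N$. If all eigenvalues of these two blocks have real part less than $-\sigma$ ($\sigma\in\mathbb R$), then there is a constant $K$ such that every closed-loop solution satisfies $\|(z;z_{R_1};\varepsilon)(t)\|\le Ke^{-\sigma(t-t_0)}\|(z;z_{R_1};\varepsilon)(t_0)\|$ for all $t\ge t_0$. 4. (Prescribed rate.) For every $\sigma>0$ there is an observer of order $q$ with all eigenvalues of $N$ having real part less than $-\sigma$; and there is a gain $Z$ such that, with every such observer, there is a constant $K$ for which all closed-loop solutions satisfy the estimate in part 3; in particular $z(t)\to0$ as $t\to\infty$. -/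

import Mathlib

open Matrix Set Filter Topology

/-! Functional observers and controllers for `x' = A x + B u`, `y = C x`.  All matrices are real;
a matrix with rows indexed by an empty type is an empty block. -/

/-- The complexification of a real matrix. -/
noncomputable def toC {ι κ : Type*} (M : Matrix ι κ ℝ) : Matrix ι κ ℂ :=
  M.map (algebraMap ℝ ℂ)

/-- The two rank conditions for an observer of the functional `S x`:
`rank (S A; C A; C; S) = rank (C A; C; S)`, and
`rank (lam S - S A; C A; C) = rank (C A; C; S)` for all complex `lam`. -/
def ObserverConditions {ν π κ : Type*} [Fintype ν] [Fintype π] [Fintype κ]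
    (A : Matrix ν ν ℝ) (C : Matrix π ν ℝ) (S : Matrix κ ν ℝ) : Prop :=
  (fromRows (S * A) (fromRows (C * A) (fromRows C S))).rank
      = (fromRows (C * A) (fromRows C S)).rank ∧
  ∀ lam : ℂ,
    (fromRows (lam • toC S - toC (S * A)) (fromRows (toC (C * A)) (toC C))).rank
      = (fromRows (C * A) (fromRows C S)).rank

/-- The two rank conditions for a controller of the functional `S x`:
`rank (S A; S) = rank S`, and `rank (lam S - S A, S B) = rank S` for all complex `lam`. -/
def ControllerConditions {ν μ κ : Type*} [Fintype ν] [Fintype μ] [Fintype κ]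
    (A : Matrix ν ν ℝ) (B : Matrix ν μ ℝ) (S : Matrix κ ν ℝ) : Prop :=
  (fromRows (S * A) S).rank = S.rank ∧
  ∀ lam : ℂ, (fromCols (lam • toC S - toC (S * A)) (toC (S * B))).rank = S.rank

/-- `G` is a generalized inverse of `S`. -/
def IsGenInverse {ν κ : Type*} [Fintype ν] [Fintype κ]
    (S : Matrix κ ν ℝ) (G : Matrix ν κ ℝ) : Prop :=
  S * G * S = S

/-- All complex eigenvalues of the real matrix `M` have real part less than `-σ`. -/
def EigenvaluesLeftOf {κ : Type*} [Fintype κ] [DecidableEq κ]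
    (M : Matrix κ κ ℝ) (σ : ℝ) : Prop :=
  ∀ z ∈ spectrum ℂ (toC M), z.re < -σ

/-- `f' = g` on `[t₀, ∞)` (one-sided derivative at `t₀`). -/
def SolvesFrom {κ : Type*} [Fintype κ] (t₀ : ℝ) (f g : ℝ → κ → ℝ) : Prop :=
  ∀ t, t₀ ≤ t → HasDerivWithinAt f (g t) (Ici t₀) t

/-- The plant `x' = A x + B u` on `[t₀, ∞)`. -/
def IsPlantTrajectory {ν μ : Type*} [Fintype ν] [Fintype μ]
    (A : Matrix ν ν ℝ) (B : Matrix ν μ ℝ) (t₀ : ℝ) (u : ℝ → μ → ℝ) (x : ℝ → ν → ℝ) : Prop :=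
  SolvesFrom t₀ x (fun t => A *ᵥ x t + B *ᵥ u t)

/-- The parameters of the observer `w' = N w + J y + H u` with estimate `w + E y`; its order is
the number of elements of `κ`. -/
structure ObserverData (μ π κ : Type*) where
  N : Matrix κ κ ℝ
  J : Matrix κ π ℝ
  H : Matrix κ μ ℝ
  E : Matrix κ π ℝ

namespace ObserverData

variable {ν μ π κ : Type*} [Fintype ν] [Fintype μ] [Fintype π] [Fintype κ]

/-- The observer equation `w' = N w + J C x + H u` on `[t₀, ∞)`. -/
def IsTrajectory (O : ObserverData μ π κ) (C : Matrix π ν ℝ) (t₀ : ℝ)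
    (u : ℝ → μ → ℝ) (x : ℝ → ν → ℝ) (w : ℝ → κ → ℝ) : Prop :=
  SolvesFrom t₀ w (fun t => O.N *ᵥ w t + O.J *ᵥ (C *ᵥ x t) + O.H *ᵥ u t)

/-- The estimate `w + E C x` of `S x`. -/
def estimate (O : ObserverData μ π κ) (C : Matrix π ν ℝ)
    (x : ℝ → ν → ℝ) (w : ℝ → κ → ℝ) (t : ℝ) : κ → ℝ :=
  w t + O.E *ᵥ (C *ᵥ x t)

/-- The estimation error: `S x` minus its estimate. -/
def error (O : ObserverData μ π κ) (C : Matrix π ν ℝ) (S : Matrix κ ν ℝ)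
    (x : ℝ → ν → ℝ) (w : ℝ → κ → ℝ) (t : ℝ) : κ → ℝ :=
  S *ᵥ x t - O.estimate C x w t

/-- `O` is an observer of `S x`: for every input and all initial conditions
the estimation error `ε` obeys `ε' = N ε`. -/
def IsFunctionalObserver (O : ObserverData μ π κ) (A : Matrix ν ν ℝ) (B : Matrix ν μ ℝ)
    (C : Matrix π ν ℝ) (S : Matrix κ ν ℝ) : Prop :=
  ∀ (t₀ : ℝ) (u : ℝ → μ → ℝ) (x : ℝ → ν → ℝ) (w : ℝ → κ → ℝ),
    IsPlantTrajectory A B t₀ u x → O.IsTrajectory C t₀ u x w →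
      SolvesFrom t₀ (O.error C S x w) (fun t => O.N *ᵥ O.error C S x w t)

end ObserverData

section ClosedLoop

variable {ν μ π κ₁ κ₂ : Type*} [Fintype ν] [Fintype μ] [Fintype π] [Fintype κ₁] [Fintype κ₂]

/-- The control `u = -Z v`, where `v` is the `κ₁`-block of the estimate. -/
def feedback (O : ObserverData μ π (κ₁ ⊕ κ₂)) (C : Matrix π ν ℝ) (Z : Matrix μ κ₁ ℝ)
    (x : ℝ → ν → ℝ) (w : ℝ → κ₁ ⊕ κ₂ → ℝ) (t : ℝ) : μ → ℝ :=
  -(Z *ᵥ fun i => O.estimate C x w t (Sum.inl i))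

/-- Plant and observer, connected by the control `feedback`, on `[t₀, ∞)`. -/
def IsClosedLoop (A : Matrix ν ν ℝ) (B : Matrix ν μ ℝ) (C : Matrix π ν ℝ)
    (O : ObserverData μ π (κ₁ ⊕ κ₂)) (Z : Matrix μ κ₁ ℝ) (t₀ : ℝ)
    (x : ℝ → ν → ℝ) (w : ℝ → κ₁ ⊕ κ₂ → ℝ) : Prop :=
  IsPlantTrajectory A B t₀ (feedback O C Z x w) x ∧
    O.IsTrajectory C t₀ (feedback O C Z x w) x w

/-- The vector `(S₁ x; ε)`, where `ε` is the error of the estimate of `(S₁; S₂) x`. -/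
def closedLoopState (C : Matrix π ν ℝ) (S₁ : Matrix κ₁ ν ℝ) (S₂ : Matrix κ₂ ν ℝ)
    (O : ObserverData μ π (κ₁ ⊕ κ₂)) (x : ℝ → ν → ℝ) (w : ℝ → κ₁ ⊕ κ₂ → ℝ) (t : ℝ) :
    κ₁ ⊕ (κ₁ ⊕ κ₂) → ℝ :=
  Sum.elim (S₁ *ᵥ x t) (O.error C (fromRows S₁ S₂) x w t)

/-- The controller block `S₁ A G - S₁ B Z`. -/
def controllerBlock (A : Matrix ν ν ℝ) (B : Matrix ν μ ℝ) (S₁ : Matrix κ₁ ν ℝ)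
    (G : Matrix ν κ₁ ℝ) (Z : Matrix μ κ₁ ℝ) : Matrix κ₁ κ₁ ℝ :=
  S₁ * A * G - S₁ * B * Z

/-- The block upper triangular matrix `(S₁ A G - S₁ B Z, S₁ B Z (I 0); 0, N)`. -/
def closedLoopMatrix [DecidableEq κ₁] (A : Matrix ν ν ℝ) (B : Matrix ν μ ℝ) (S₁ : Matrix κ₁ ν ℝ)
    (G : Matrix ν κ₁ ℝ) (Z : Matrix μ κ₁ ℝ) (N : Matrix (κ₁ ⊕ κ₂) (κ₁ ⊕ κ₂) ℝ) :
    Matrix (κ₁ ⊕ (κ₁ ⊕ κ₂)) (κ₁ ⊕ (κ₁ ⊕ κ₂)) ℝ :=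
  fromBlocks (controllerBlock A B S₁ G Z)
    (S₁ * B * Z * fromCols (1 : Matrix κ₁ κ₁ ℝ) (0 : Matrix κ₁ κ₂ ℝ)) 0 N

/-- All solutions of the closed loop satisfy
`‖(S₁ x; ε)(t)‖ ≤ K exp (-σ (t - t₀)) ‖(S₁ x; ε)(t₀)‖` for `t ≥ t₀`, with one constant `K`. -/
def ClosedLoopDecays (A : Matrix ν ν ℝ) (B : Matrix ν μ ℝ) (C : Matrix π ν ℝ)
    (S₁ : Matrix κ₁ ν ℝ) (S₂ : Matrix κ₂ ν ℝ)
    (O : ObserverData μ π (κ₁ ⊕ κ₂)) (Z : Matrix μ κ₁ ℝ) (σ : ℝ) : Prop :=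
  ∃ K : ℝ, ∀ (t₀ : ℝ) (x : ℝ → ν → ℝ) (w : ℝ → κ₁ ⊕ κ₂ → ℝ), IsClosedLoop A B C O Z t₀ x w →
    ∀ t, t₀ ≤ t → ‖closedLoopState C S₁ S₂ O x w t‖
      ≤ K * Real.exp (-σ * (t - t₀)) * ‖closedLoopState C S₁ S₂ O x w t₀‖

end ClosedLoop

/-! The rank condition on `(S₁ A; S₁)` makes the rows of `S₁ A` combinations of the rows of `S₁`, so
`S₁ x` obeys a closed linear equation driven by `u`. The feedback is `-Z S₁ x` plus a linear term in
the error, and the error evolves by `N` whatever the input. Hence `(S₁ x; ε)` has a block triangular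
dynamics whose coupling block does not affect the eigenvalues; this is the separation.

Both designs reduce to pole placement for a real pair passing the Hautus test over `ℂ`
(`exists_charpoly_sub_mul_eq`), obtained from Heymann's lemma and Ackermann's formula. For the
controller the test is the second rank condition on `S₁`. For the observer one solves `(E, K, N) (C
A; C; S) = S A`; the free parameter of the solution acts on `N` as an output injection, and the
transposed pair passes the test by the second observer condition.

Decay comes from Cayley–Hamilton, removing one linear factor of the characteristic polynomial at a
time. If the rows of `S₁` are dependent, a rank factorization `S₁ = T P` moves the argument to the
coordinates `P x`. -/

/-! ### Pole placement for controllable pairs over a field. -/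

section PolePlacement

variable {K V U : Type*} [Field K] [AddCommGroup V] [Module K V] [AddCommGroup U] [Module K U]

/-- `(T, B)` is controllable: no proper `T`-invariant subspace contains the range of `B`. -/
def IsControllablePair (T : V →ₗ[K] V) (B : U →ₗ[K] V) : Prop :=
  ∀ W : Submodule K V, (∀ w ∈ W, T w ∈ W) → (∀ u, B u ∈ W) → W = ⊤

/-- Feedback alters `T` only by vectors in the range of `B`, so the subspaces containing that range
have the same invariance under both maps. -/
theorem IsControllablePair.sub_comp {T : V →ₗ[K] V} {B : U →ₗ[K] V}
    (h : IsControllablePair T B) (Z : V →ₗ[K] U) : IsControllablePair (T - B ∘ₗ Z) B := by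
  intro W hT hB
  refine h W (fun w hw => ?_) hB
  simpa using W.add_mem (hT w hw) (hB (Z w))

/-- If the orbit `T ^ i b`, `i < k`, is linearly independent, a coordinate functional picks out
its last element. -/
theorem exists_dual_eq_one_last {v : ℕ → V} {k : ℕ}
    (hv : LinearIndependent K fun i : Fin (k + 1) => v i) :
    ∃ φ : V →ₗ[K] K, (∀ i < k, φ (v i) = 0) ∧ φ (v k) = 1 := by
  have h : LinearIndependent K (Fin.snoc (fun i : Fin k => v i) (v k) : Fin (k + 1) → V) := by
    convert hv using 1
    ext i
    refine Fin.lastCases ?_ (fun i => ?_) i <;> simp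
  obtain ⟨φ, hφ, hker⟩ := Submodule.exists_le_ker_of_notMem (linearIndependent_finSnoc.1 h).2
  refine ⟨(φ (v k))⁻¹ • φ, fun i hi => ?_, by simp [hφ]⟩
  have : v i ∈ LinearMap.ker φ := hker (Submodule.subset_span ⟨⟨i, hi⟩, rfl⟩)
  simp [LinearMap.mem_ker.1 this]

/-- Heymann's lemma: a feedback makes a controllable pair controllable from one input. -/
theorem IsControllablePair.exists_linearIndependent_orbit [FiniteDimensional K V]
    {T : V →ₗ[K] V} {B : U →ₗ[K] V} (h : IsControllablePair T B) :
    ∀ k ≤ Module.finrank K V, ∃ (Z : V →ₗ[K] U) (u : U),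
      LinearIndependent K fun i : Fin k => ((T - B ∘ₗ Z) ^ (i : ℕ)) (B u) := by
  intro k
  induction k with
  | zero => exact fun _ => ⟨0, 0, linearIndependent_empty_type⟩
  | succ k ih =>
    intro hk
    obtain ⟨Z, u, hli⟩ := ih (by omega)
    rcases Nat.eq_zero_or_pos k with rfl | hpos
    · by_contra! hno
      have hB : ∀ u, B u = 0 := by
        intro u
        by_contra hu
        exact hno 0 u (by
          change LinearIndependent K fun i : Fin 1 => _
          rw [linearIndependent_unique_iff]
          simpa using hu)
      have := h ⊥ (by simp) (by simp [hB])
      have h0 : Module.finrank K V = 0 := by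
        rw [← finrank_top, ← this, finrank_bot]
      omega
    obtain ⟨k, rfl⟩ : ∃ l, k = l + 1 := ⟨k - 1, by omega⟩
    set D := T - B ∘ₗ Z with hD
    set W := Submodule.span K (Set.range fun i : Fin (k + 1) => (D ^ (i : ℕ)) (B u)) with hW
    have hmem : ∀ i < k + 1, (D ^ i) (B u) ∈ W := fun i hi =>
      Submodule.subset_span ⟨⟨i, hi⟩, rfl⟩
    -- Either some input pushes the next orbit vector out of the span `W`, or `W` is invariant and
    -- contains the range of `B`, which contradicts its dimension.
    by_cases hex : ∃ u', D ((D ^ k) (B u)) + B u' ∉ W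
    · obtain ⟨u', hu'⟩ := hex
      obtain ⟨φ, hφ0, hφ1⟩ := exists_dual_eq_one_last (v := fun i => (D ^ i) (B u)) hli
      -- As `φ` vanishes on all orbit vectors but the last, this correction keeps the old orbit and
      -- shifts only the new vector, by `B u'`.
      refine ⟨Z - φ.smulRight u', u, ?_⟩
      set D' := T - B ∘ₗ (Z - φ.smulRight u') with hD'
      have hDD : ∀ x, D' x = D x + φ x • B u' := by
        intro x
        simp [hD, hD']
        abel
      have hpow : ∀ i ≤ k, (D' ^ i) (B u) = (D ^ i) (B u) := by
        intro i
        induction i with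
        | zero => simp
        | succ i ihi =>
          intro hi
          rw [pow_succ', Module.End.mul_apply, ihi (by omega), hDD, hφ0 i (by omega),
            pow_succ', Module.End.mul_apply]
          simp
      have hlast : (D' ^ (k + 1)) (B u) = D ((D ^ k) (B u)) + B u' := by
        rw [pow_succ', Module.End.mul_apply, hpow k le_rfl, hDD]
        simp only [hφ1, one_smul]
      have := linearIndependent_finSnoc.2 ⟨hli, hu'⟩
      convert this using 1
      ext i
      refine Fin.lastCases ?_ (fun i => ?_) i
      · simp [hlast]
      · simpa using hpow i (by omega)
    · push Not at hex
      -- The input `0` puts the next orbit vector in `W`; subtracting it from the general case puts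
      -- every `B u'` in `W`.
      have hDk : D ((D ^ k) (B u)) ∈ W := by simpa using hex 0
      have htop : W = ⊤ := by
        refine h.sub_comp Z W (fun w hw => ?_) (fun u' => ?_)
        · refine Submodule.span_induction (p := fun w _ => D w ∈ W) ?_ (by simp) ?_ ?_ hw
          · rintro _ ⟨i, rfl⟩
            rcases Nat.lt_or_ge i k with hi | hi
            · simpa [pow_succ'] using hmem (i + 1) (by omega)
            · have : (i : ℕ) = k := by omega
              simpa [this] using hDk
          · intro x y _ _ hx hy
            simpa using W.add_mem hx hy
          · intro a x _ hx
            simpa using W.smul_mem a hx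
        · simpa using W.sub_mem (hex u') hDk
      have := finrank_range_le_card (R := K) fun i : Fin (k + 1) => (D ^ (i : ℕ)) (B u)
      rw [Set.finrank, ← hW, htop, finrank_top, Fintype.card_fin] at this
      omega

/-- An endomorphism with a cyclic vector annihilated by the monic `f` of full degree has
characteristic polynomial `f`. -/
theorem charpoly_eq_of_cyclic [FiniteDimensional K V] {T : V →ₗ[K] V} {b : V}
    (hb : ∀ W : Submodule K V, (∀ w ∈ W, T w ∈ W) → b ∈ W → W = ⊤)
    {f : Polynomial K} (hf : f.Monic) (hdeg : f.natDegree = Module.finrank K V)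
    (hfb : Polynomial.aeval T f b = 0) : T.charpoly = f := by
  have hcomm : ∀ (p : Polynomial K) x,
      Polynomial.aeval T p (T x) = T (Polynomial.aeval T p x) := by
    intro p x
    have := congrArg (Polynomial.aeval T) (mul_comm p Polynomial.X)
    rw [map_mul, map_mul, Polynomial.aeval_X] at this
    exact LinearMap.congr_fun this x
  -- The kernel of `f(T)` is invariant and contains the cyclic vector.
  have hf0 : Polynomial.aeval T f = 0 := by
    have := hb (LinearMap.ker (Polynomial.aeval T f)) (fun w hw => by
      rw [LinearMap.mem_ker] at hw ⊢
      rw [hcomm, hw, map_zero]) hfb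
    exact LinearMap.ker_eq_top.1 this
  set m := minpoly K T with hm
  have hint : IsIntegral K T := Algebra.IsIntegral.isIntegral T
  have hmm : m.Monic := minpoly.monic hint
  have hle : Module.finrank K V ≤ m.natDegree := by
    have hspan : Submodule.span K (Set.range fun i : Fin m.natDegree => (T ^ (i : ℕ)) b) = ⊤ := by
      have hall : ∀ p : Polynomial K, Polynomial.aeval T p b ∈
          Submodule.span K (Set.range fun i : Fin m.natDegree => (T ^ (i : ℕ)) b) := by
        intro p
        rw [← Polynomial.modByMonic_add_div p m]
        rw [map_add, map_mul, minpoly.aeval, zero_mul, add_zero]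
        rcases eq_or_ne m 1 with h1 | h1
        · rw [h1]; simp
        rw [Polynomial.aeval_eq_sum_range' (Polynomial.natDegree_modByMonic_lt p hmm h1)]
        simp only [LinearMap.sum_apply, LinearMap.smul_apply]
        refine Submodule.sum_mem _ fun i hi => Submodule.smul_mem _ _ (Submodule.subset_span ?_)
        exact ⟨⟨i, Finset.mem_range.1 hi⟩, rfl⟩
      refine hb _ (fun w hw => ?_) (by simpa using hall 1)
      refine Submodule.span_induction (p := fun w _ => T w ∈ Submodule.span K
        (Set.range fun i : Fin m.natDegree => (T ^ (i : ℕ)) b)) ?_ (by simp) ?_ ?_ hw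
      · rintro _ ⟨i, rfl⟩
        simpa [pow_succ'] using hall (Polynomial.X ^ ((i : ℕ) + 1))
      · intro x y _ _ hx hy
        simpa using Submodule.add_mem _ hx hy
      · intro a x _ hx
        simpa using Submodule.smul_mem _ a hx
    have := finrank_range_le_card (R := K) fun i : Fin m.natDegree => (T ^ (i : ℕ)) b
    rwa [Set.finrank, hspan, finrank_top, Fintype.card_fin] at this
  -- Both `f` and the characteristic polynomial are monic multiples of `m`, of degree at most that
  -- of `m`.
  have h1 : f = m := Polynomial.eq_of_monic_of_dvd_of_natDegree_le hmm hf (minpoly.dvd K T hf0)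
    (by omega)
  have h2 : T.charpoly = m := Polynomial.eq_of_monic_of_dvd_of_natDegree_le hmm
    (LinearMap.charpoly_monic T) (LinearMap.minpoly_dvd_charpoly T)
    (by rw [LinearMap.charpoly_natDegree]; exact hle)
  rw [h2, h1]

/-- Ackermann's formula: single-input pole placement. -/
theorem exists_charpoly_sub_smulRight_eq [FiniteDimensional K V] {T : V →ₗ[K] V} {b : V}
    (hli : LinearIndependent K fun i : Fin (Module.finrank K V) => (T ^ (i : ℕ)) b)
    {f : Polynomial K} (hf : f.Monic) (hdeg : f.natDegree = Module.finrank K V) :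
    ∃ k : V →ₗ[K] K, (T - k.smulRight b).charpoly = f := by
  have hspan := hli.span_eq_top_of_card_eq_finrank' (by simp)
  rcases Nat.eq_zero_or_pos (Module.finrank K V) with h0 | hpos
  · have := Module.finrank_zero_iff.1 h0
    refine ⟨0, charpoly_eq_of_cyclic (b := b) (fun W _ _ => Subsingleton.elim _ _) hf hdeg
      (Subsingleton.elim _ _)⟩
  obtain ⟨d, hd⟩ : ∃ d, Module.finrank K V = d + 1 := ⟨Module.finrank K V - 1, by omega⟩
  rw [hd] at hli hspan hdeg
  obtain ⟨φ, hφ0, hφ1⟩ := exists_dual_eq_one_last (v := fun i => (T ^ i) b) hli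
  refine ⟨φ ∘ₗ Polynomial.aeval T f, ?_⟩
  set D := T - (φ ∘ₗ Polynomial.aeval T f).smulRight b with hD
  have hDx : ∀ x, D x = T x - φ (Polynomial.aeval T f x) • b := fun x => by simp [hD]
  have hcyc : ∀ W : Submodule K V, (∀ w ∈ W, D w ∈ W) → b ∈ W → W = ⊤ := by
    intro W hW hbW
    have hT : ∀ w ∈ W, T w ∈ W := fun w hw => by
      have := W.add_mem (hW w hw) (W.smul_mem (φ (Polynomial.aeval T f w)) hbW)
      rwa [hDx, sub_add_cancel] at this
    have hpow : ∀ i, (T ^ i) b ∈ W := by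
      intro i
      induction i with
      | zero => simpa using hbW
      | succ i ih => simpa [pow_succ'] using hT _ ih
    rw [eq_top_iff, ← hspan, Submodule.span_le]
    rintro _ ⟨i, rfl⟩
    exact hpow i
  -- The feedback enters along `b`, and `φ` first sees `b` after `d` applications of `T`.
  have hpow : ∀ j ≤ d, ∀ x, φ ((D ^ j) x) = φ ((T ^ j) x) := by
    intro j
    induction j with
    | zero => simp
    | succ j ih =>
      intro hj x
      rw [pow_succ, Module.End.mul_apply, ih (by omega), hDx, map_sub, map_sub, map_smul, map_smul,
        hφ0 j (by omega), pow_succ, Module.End.mul_apply]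
      simp
  -- Replacing `T` by `D` changes only the leading term of `φ (f(·) x)`, which drops by exactly `φ
  -- (f(T) x)`.
  have hfD : ∀ x, φ (Polynomial.aeval D f x) = 0 := by
    intro x
    have hexp : ∀ S : V →ₗ[K] V, φ (Polynomial.aeval S f x)
        = (∑ i ∈ Finset.range (d + 1), f.coeff i * φ ((S ^ i) x)) + φ ((S ^ d) (S x)) := by
      intro S
      have hlast : f.coeff (d + 1) = 1 := by
        rw [← hdeg]; exact hf
      rw [Polynomial.aeval_eq_sum_range' (n := d + 2) (by omega), Finset.sum_range_succ, hlast]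
      simp [LinearMap.sum_apply, pow_succ]
    have hT := hexp T
    rw [hexp D, hpow d le_rfl, hDx, map_sub, map_sub, map_smul, map_smul, hφ1, hT,
      Finset.sum_congr rfl fun i hi => by rw [hpow i (by have := Finset.mem_range.1 hi; omega)]]
    simp
  have hsep : ∀ x, (∀ j ≤ d, φ ((D ^ j) x) = 0) → x = 0 := by
    intro x hx
    have hx' : ∀ j ≤ d, φ ((T ^ j) x) = 0 := fun j hj => by rw [← hpow j hj, hx j hj]
    have hmem : x ∈ Submodule.span K (Set.range fun i : Fin (d + 1) => (T ^ (i : ℕ)) b) := by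
      rw [hspan]; trivial
    obtain ⟨c, rfl⟩ := (Submodule.mem_span_range_iff_exists_fun K).1 hmem
    -- The array `φ (T ^ (i + j) b)` is zero for `i + j < d` and one for `i + j = d`, so the
    -- coefficients vanish successively from the top index down.
    have hc : ∀ l, ∀ i : Fin (d + 1), d - l ≤ i → c i = 0 := by
      intro l
      induction l using Nat.strong_induction_on with
      | _ l ih =>
        intro i hi
        by_cases hlt : ∃ l' < l, d - l' ≤ i
        · obtain ⟨l', h1, h2⟩ := hlt
          exact ih l' h1 i h2
        push Not at hlt
        have hil : (i : ℕ) + (d - i) = d := by omega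
        have key := hx' (d - i) (by omega)
        rw [map_sum, map_sum, Finset.sum_eq_single i] at key
        · rw [map_smul, map_smul, ← Module.End.mul_apply, ← pow_add, add_comm, hil, hφ1] at key
          simpa using key
        · intro j _ hji
          rcases lt_or_gt_of_ne hji with h | h
          · rw [map_smul, map_smul, ← Module.End.mul_apply, ← pow_add, hφ0 _ (by omega), smul_zero]
          · have : c j = 0 := by
              rcases Nat.eq_zero_or_pos l with hl | hl
              · omega
              · exact ih (l - 1) (by omega) j (by
                  have := hlt (l - 1) (by omega)
                  omega)
            simp [this]
        · simp
    exact Finset.sum_eq_zero fun i _ => by rw [hc d i (by omega), zero_smul]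
  refine charpoly_eq_of_cyclic hcyc hf (by omega) (hsep _ fun j _ => ?_)
  rw [← Module.End.mul_apply]
  have : D ^ j * Polynomial.aeval D f = Polynomial.aeval D f * D ^ j := by
    have h1 : D ^ j = Polynomial.aeval D (Polynomial.X ^ j : Polynomial K) := by simp
    rw [h1, ← map_mul, ← map_mul, mul_comm]
  rw [this, Module.End.mul_apply, hfD]

/-- Wonham's pole placement theorem. -/
theorem IsControllablePair.exists_charpoly_eq [FiniteDimensional K V]
    {T : V →ₗ[K] V} {B : U →ₗ[K] V} (h : IsControllablePair T B)
    {f : Polynomial K} (hf : f.Monic) (hdeg : f.natDegree = Module.finrank K V) :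
    ∃ Z : V →ₗ[K] U, (T - B ∘ₗ Z).charpoly = f := by
  obtain ⟨Z, u, hli⟩ := h.exists_linearIndependent_orbit _ le_rfl
  obtain ⟨k, hk⟩ := exists_charpoly_sub_smulRight_eq hli hf hdeg
  refine ⟨Z + k.smulRight u, ?_⟩
  rw [← hk]
  congr 1
  ext x
  simp [sub_sub]

end PolePlacement

/-! ### The Hautus test over the complex numbers. -/

section Complexification

variable {α β γ : Type*}

theorem toC_mul [Fintype β] (M : Matrix α β ℝ) (N : Matrix β γ ℝ) :
    toC (M * N) = toC M * toC N :=
  Matrix.map_mul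

theorem toC_sub (M N : Matrix α β ℝ) : toC (M - N) = toC M - toC N := by
  ext; simp [toC]

theorem toC_one [DecidableEq α] : toC (1 : Matrix α α ℝ) = 1 := by
  simp [toC]

theorem toC_transpose (M : Matrix α β ℝ) : toC Mᵀ = (toC M)ᵀ := rfl

theorem toC_fromRows (M : Matrix α γ ℝ) (N : Matrix β γ ℝ) :
    toC (fromRows M N) = fromRows (toC M) (toC N) :=
  fromRows_map _ _ _

/-- A real matrix pair satisfying the Hautus test over `ℂ` admits arbitrary pole placement. -/
theorem exists_charpoly_sub_mul_eq [Fintype α] [DecidableEq α] [Fintype β]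
    (M : Matrix α α ℝ) (B : Matrix α β ℝ)
    (h : ∀ (c : ℂ) (w : α → ℂ), w ᵥ* toC M = c • w → w ᵥ* toC B = 0 → w = 0)
    {f : Polynomial ℝ} (hf : f.Monic) (hdeg : f.natDegree = Fintype.card α) :
    ∃ Z : Matrix β α ℝ, (M - B * Z).charpoly = f := by
  classical
  -- This is the space of row vectors annihilating the whole controllable subspace. It is invariant
  -- under `M`, so if nonzero it contains a left eigenvector, which the test excludes.
  let W : Submodule ℂ (α → ℂ) := ⨅ k : ℕ, LinearMap.ker (toC (M ^ k * B)).vecMulLinear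
  have hW : ∀ w, w ∈ W ↔ ∀ k : ℕ, w ᵥ* toC (M ^ k * B) = 0 := by
    intro w; simp [W]
  have hbot : W = ⊥ := by
    by_contra hne
    have hnt : Nontrivial W := Submodule.nontrivial_iff_ne_bot.2 hne
    have hinv : ∀ w ∈ W, (toC M).vecMulLinear w ∈ W := by
      intro w hw
      rw [hW] at hw ⊢
      intro k
      simpa [pow_succ', Matrix.mul_assoc, toC_mul] using hw (k + 1)
    obtain ⟨c, hc⟩ := Module.End.exists_eigenvalue ((toC M).vecMulLinear.restrict hinv)
    obtain ⟨v, hv⟩ := hc.exists_hasEigenvector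
    refine hv.2 (Subtype.ext (h c v ?_ ?_))
    · simpa using congrArg Subtype.val hv.apply_eq_smul
    · simpa using (hW v).1 v.2 0
  -- A functional vanishing on a proper invariant subspace that contains the range of `B` becomes,
  -- after complexification, an element of `W`.
  have hctr : IsControllablePair M.mulVecLin B.mulVecLin := by
    intro P hP hB
    by_contra hne
    obtain ⟨φ, hφ, hker⟩ := Submodule.exists_le_ker_of_lt_top P (lt_top_iff_ne_top.2 hne)
    have hpow : ∀ (k : ℕ) u, (M ^ k * B) *ᵥ u ∈ P := by
      intro k
      induction k with
      | zero => intro u; simpa using hB u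
      | succ k ih =>
        intro u
        have := hP _ (ih u)
        rwa [mulVecLin_apply, mulVec_mulVec, ← Matrix.mul_assoc, ← pow_succ'] at this
    let v : α → ℝ := fun i => φ (Pi.single i 1)
    have hv : ∀ x, φ x = v ⬝ᵥ x := by
      intro x
      conv_lhs => rw [pi_eq_sum_univ' x]
      simp [v, dotProduct, mul_comm]
    have hzero : ∀ k : ℕ, v ᵥ* (M ^ k * B) = 0 := by
      intro k
      refine dotProduct_eq_zero _ fun u => ?_
      rw [← dotProduct_mulVec, ← hv]
      exact hker (hpow k u)
    have hmem : (algebraMap ℝ ℂ ∘ v) ∈ W := by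
      rw [hW]
      intro k
      ext i
      have := RingHom.map_vecMul (algebraMap ℝ ℂ) (M ^ k * B) v i
      rw [hzero k] at this
      simpa [toC] using this.symm
    rw [hbot, Submodule.mem_bot] at hmem
    refine hφ (LinearMap.ext fun x => ?_)
    have : v = 0 := by
      ext i
      simpa using congrFun hmem i
    rw [hv, this]
    simp
  obtain ⟨Z, hZ⟩ := hctr.exists_charpoly_eq hf (by simpa using hdeg)
  refine ⟨LinearMap.toMatrix' Z, ?_⟩
  rw [← hZ, ← charpoly_mulVecLin]
  congr 1
  refine LinearMap.ext fun x => ?_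
  simp [LinearMap.toMatrix'_mulVec]

end Complexification

/-! ### Rank equalities turned into kernel inclusions and factorizations. -/

section Rank

variable {α β γ : Type*} [Fintype γ]

/-- Rank factorization over the reals, with one-sided inverses of the factors. -/
theorem exists_rank_factorization [Fintype α] [Fintype β] (M : Matrix α β ℝ) :
    ∃ (k : ℕ) (T : Matrix α (Fin k) ℝ) (S : Matrix (Fin k) β ℝ)
      (L : Matrix (Fin k) α ℝ) (R : Matrix β (Fin k) ℝ),
      M.rank = k ∧ M = T * S ∧ L * T = 1 ∧ S * R = 1 := by
  classical
  let e : LinearMap.range M.mulVecLin ≃ₗ[ℝ] (Fin M.rank → ℝ) :=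
    LinearEquiv.ofFinrankEq _ _ (by rw [Module.finrank_fin_fun, Matrix.rank])
  let t : (Fin M.rank → ℝ) →ₗ[ℝ] (α → ℝ) := (LinearMap.range M.mulVecLin).subtype ∘ₗ e.symm
  let s : (β → ℝ) →ₗ[ℝ] (Fin M.rank → ℝ) := e ∘ₗ M.mulVecLin.rangeRestrict
  obtain ⟨l, hl⟩ := t.exists_leftInverse_of_injective (LinearMap.ker_eq_bot.2
    ((Submodule.injective_subtype _).comp e.symm.injective))
  obtain ⟨r, hr⟩ := s.exists_rightInverse_of_surjective (LinearMap.range_eq_top.2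
    (e.surjective.comp M.mulVecLin.surjective_rangeRestrict))
  refine ⟨_, LinearMap.toMatrix' t, LinearMap.toMatrix' s, LinearMap.toMatrix' l,
    LinearMap.toMatrix' r, rfl, ?_, ?_, ?_⟩
  · rw [← LinearMap.toMatrix'_comp]
    have : t ∘ₗ s = Matrix.toLin' M := by
      ext; simp [t, s]
    rw [this, LinearMap.toMatrix'_toLin']
  · rw [← LinearMap.toMatrix'_comp, hl, LinearMap.toMatrix'_id]
  · rw [← LinearMap.toMatrix'_comp, hr, LinearMap.toMatrix'_id]

theorem exists_isGenInverse [Fintype α] [Fintype β] (M : Matrix α β ℝ) :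
    ∃ G, IsGenInverse M G := by
  obtain ⟨k, T, S, L, R, -, rfl, hL, hR⟩ := exists_rank_factorization M
  refine ⟨R * L, ?_⟩
  rw [IsGenInverse]
  calc T * S * (R * L) * (T * S) = T * (S * R) * (L * T) * S := by simp only [Matrix.mul_assoc]
    _ = T * S := by rw [hR, hL, Matrix.mul_one, Matrix.mul_one]

/-- Complexification preserves the rank. -/
theorem rank_toC [Fintype α] [Fintype β] (M : Matrix α β ℝ) : (toC M).rank = M.rank := by
  obtain ⟨k, T, S, L, R, hk, rfl, hL, hR⟩ := exists_rank_factorization M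
  -- The one-sided inverses certify the rank and survive complexification.
  have hL' : toC L * toC T = 1 := by rw [← toC_mul, hL, toC_one]
  have hR' : toC S * toC R = 1 := by rw [← toC_mul, hR, toC_one]
  rw [hk, toC_mul]
  apply le_antisymm
  · exact (Matrix.rank_mul_le_left _ _).trans ((Matrix.rank_le_card_width _).trans (by simp))
  · have h1 : toC L * (toC T * toC S) * toC R = 1 := by
      rw [← Matrix.mul_assoc, hL', Matrix.one_mul, hR']
    have h2 : (toC L * (toC T * toC S) * toC R).rank = k := by rw [h1, Matrix.rank_one]; simp
    exact h2.ge.trans <|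
      (Matrix.rank_mul_le_left _ _).trans (Matrix.rank_mul_le_right _ _)

/-- If the kernels are nested and the ranks agree, the kernels agree. -/
theorem mulVec_eq_zero_of_rank_eq {K : Type*} [Field K] {P : Matrix α γ K} {Q : Matrix β γ K}
    (h : ∀ v, P *ᵥ v = 0 → Q *ᵥ v = 0) (hrank : P.rank = Q.rank) {v : γ → K}
    (hv : Q *ᵥ v = 0) : P *ᵥ v = 0 := by
  have hP := P.mulVecLin.finrank_range_add_finrank_ker
  have hQ := Q.mulVecLin.finrank_range_add_finrank_ker
  have hle : LinearMap.ker P.mulVecLin ≤ LinearMap.ker Q.mulVecLin := fun v hv => h v hv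
  have := Submodule.eq_of_le_of_finrank_eq hle (by
    simp only [Matrix.rank] at hrank
    omega)
  have hv' : v ∈ LinearMap.ker Q.mulVecLin := hv
  rw [← this] at hv'
  exact hv'

theorem vecMul_eq_zero_of_rank_eq [Fintype α] [Fintype β] {K : Type*} [Field K] {P : Matrix γ α K} {Q : Matrix γ β K}
    (h : ∀ v, v ᵥ* P = 0 → v ᵥ* Q = 0) (hrank : P.rank = Q.rank) {v : γ → K}
    (hv : v ᵥ* Q = 0) : v ᵥ* P = 0 := by
  rw [← mulVec_transpose] at hv ⊢
  refine mulVec_eq_zero_of_rank_eq (fun v hv => ?_) ?_ hv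
  · rw [mulVec_transpose] at hv ⊢
    exact h v hv
  · rw [rank_transpose, rank_transpose, hrank]

/-- If stacking `P` on `Q` does not raise the rank, then `P` factors through `Q`. -/
theorem mul_genInverse_mul_of_rank_fromRows [Fintype β] {P : Matrix α γ ℝ} {Q : Matrix β γ ℝ}
    {G : Matrix γ β ℝ} (hG : IsGenInverse Q G) (hrank : (fromRows P Q).rank = Q.rank) :
    P * G * Q = P := by
  classical
  -- The columns of `1 - G * Q` lie in the kernel of `Q`, which by the rank equality is also the
  -- kernel of the stacked matrix.
  have hz : P * (1 - G * Q) = 0 := by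
    refine Matrix.ext_of_mulVec_single fun i => ?_
    have hQ : Q *ᵥ ((1 - G * Q) *ᵥ Pi.single i 1) = 0 := by
      rw [mulVec_mulVec, Matrix.mul_sub, ← Matrix.mul_assoc, hG, Matrix.mul_one, sub_self,
        zero_mulVec]
    have := mulVec_eq_zero_of_rank_eq (P := fromRows P Q) (Q := Q) (fun v hv => by
      rw [fromRows_mulVec] at hv
      ext j
      exact congrFun hv (Sum.inr j)) hrank hQ
    rw [fromRows_mulVec] at this
    rw [← mulVec_mulVec, zero_mulVec]
    ext j
    exact congrFun this (Sum.inl j)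
  rw [Matrix.mul_sub, Matrix.mul_one, sub_eq_zero, ← Matrix.mul_assoc] at hz
  exact hz.symm

end Rank

/-! ### Exponential decay and existence of solutions. -/

section Decay

variable {E : Type*} [NormedAddCommGroup E]

/-- Exponential decay of the solutions of `s' = A s` that are annihilated by `∏ (A - c)`,
where all the `c` have real part less than `-σ`. -/
theorem exists_norm_le_of_aeval_prod_eq_zero [NormedSpace ℂ E] (A : E →L[ℂ] E) (σ : ℝ)
    (l : Multiset ℂ) (hl : ∀ c ∈ l, c.re < -σ) :
    ∃ K : ℝ, 0 ≤ K ∧ ∀ (t₀ : ℝ) (s : ℝ → E),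
      (∀ t, t₀ ≤ t → HasDerivWithinAt s (A (s t)) (Ici t₀) t) →
      (∀ t, t₀ ≤ t →
        Polynomial.aeval A (l.map fun c => Polynomial.X - Polynomial.C c).prod (s t) = 0) →
      ∀ t, t₀ ≤ t → ‖s t‖ ≤ K * Real.exp (-σ * (t - t₀)) * ‖s t₀‖ := by
  induction l using Multiset.induction_on with
  | empty =>
    refine ⟨0, le_rfl, fun t₀ s _ h t ht => ?_⟩
    simpa using h t ht
  | cons c l ih =>
    obtain ⟨K, hK, ih⟩ := ih fun d hd => hl d (Multiset.mem_cons_of_mem hd)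
    -- `D s` solves the same equation with one factor fewer, so it decays by induction; `s` is
    -- recovered by integrating `(exp (-c t) s)' = exp (-c t) D s`.
    set D : E →L[ℂ] E := A - algebraMap ℂ (E →L[ℂ] E) c with hD
    have hDx : ∀ x, D x = A x - c • x := fun x => by
      simp [hD, Algebra.algebraMap_eq_smul_one]
    -- The strict gap absorbs the polynomial factors that repeated eigenvalues would produce.
    have ha : 0 < -c.re - σ := by
      have := hl c (Multiset.mem_cons_self c l)
      linarith
    set a := -c.re - σ with ha_def
    refine ⟨1 + K * ‖D‖ / a, by positivity, fun t₀ s hs hann t ht => ?_⟩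
    have hv : ∀ t, t₀ ≤ t → ‖D (s t)‖ ≤ K * Real.exp (-σ * (t - t₀)) * ‖D (s t₀)‖ := by
      refine ih t₀ (fun t => D (s t)) (fun t ht => ?_) (fun t ht => ?_)
      · have h1 : A (D (s t)) = D (A (s t)) := by simp [hDx]
        rw [h1]
        exact (D.restrictScalars ℝ).hasFDerivAt.comp_hasDerivWithinAt t (hs t ht)
      · have := hann t ht
        rw [Multiset.map_cons, Multiset.prod_cons, mul_comm, map_mul, map_sub, Polynomial.aeval_X,
          Polynomial.aeval_C] at this
        exact this
    set k := K * ‖D‖ * ‖s t₀‖ with hk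
    have hk0 : 0 ≤ k := by positivity
    have hexp : ∀ t : ℝ, HasDerivAt (fun t : ℝ => Complex.exp (-c * (t - t₀)))
        (Complex.exp (-c * (t - t₀)) * -c) t := by
      intro t
      have h1 : HasDerivAt (fun t : ℝ => -c * ((t : ℂ) - t₀)) (-c) t := by
        simpa using ((Complex.ofRealCLM.hasDerivAt (x := t)).sub_const (t₀ : ℂ)).const_mul (-c)
      exact h1.cexp
    have hnexp : ∀ t : ℝ, ‖Complex.exp (-c * (t - t₀))‖ = Real.exp (-c.re * (t - t₀)) := by
      intro t
      rw [Complex.norm_exp]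
      simp
    have hg : ∀ t, t₀ ≤ t → HasDerivWithinAt (fun t : ℝ => Complex.exp (-c * (t - t₀)) • s t)
        (Complex.exp (-c * (t - t₀)) • D (s t)) (Ici t₀) t := by
      intro t ht
      refine ((hexp t).hasDerivWithinAt.smul (hs t ht)).congr_deriv ?_
      rw [hDx]
      module
    -- The majorant is `‖s t₀‖` plus the integral of `k exp (a (t - t₀))`; its coefficient `k / a`
    -- gives the constant `1 + K * ‖D‖ / a`.
    have hB : ∀ t : ℝ, HasDerivAt
        (fun t => ‖s t₀‖ + k / a * (Real.exp (a * (t - t₀)) - 1))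
        (k * Real.exp (a * (t - t₀))) t := by
      intro t
      have h1 : HasDerivAt (fun t : ℝ => a * (t - t₀)) a t := by
        simpa using ((hasDerivAt_id t).sub_const t₀).const_mul a
      exact (((h1.exp.sub_const 1).const_mul (k / a)).const_add ‖s t₀‖).congr_deriv (by
        field_simp)
    have hbound := image_norm_le_of_norm_deriv_right_le_deriv_boundary (a := t₀) (b := t)
      (f := fun t : ℝ => Complex.exp (-c * (t - t₀)) • s t)
      (f' := fun t : ℝ => Complex.exp (-c * (t - t₀)) • D (s t))
      (fun x hx => ((hg x hx.1).continuousWithinAt).mono Icc_subset_Ici_self)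
      (fun x hx => (hg x hx.1).mono (Ici_subset_Ici.2 hx.1)) (by simp) hB
      (fun x hx => by
        rw [norm_smul, hnexp]
        calc Real.exp (-c.re * (x - t₀)) * ‖D (s x)‖
            ≤ Real.exp (-c.re * (x - t₀)) *
              (K * Real.exp (-σ * (x - t₀)) * (‖D‖ * ‖s t₀‖)) := by
              gcongr
              refine (hv x hx.1).trans ?_
              gcongr
              exact D.le_opNorm _
          _ = k * (Real.exp (-c.re * (x - t₀)) * Real.exp (-σ * (x - t₀))) := by
              rw [hk]; ring
          _ = k * Real.exp (a * (x - t₀)) := by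
              rw [← Real.exp_add, ha_def]; ring_nf) (right_mem_Icc.2 ht)
    rw [norm_smul, hnexp] at hbound
    have h1 : ‖s t‖ = Real.exp (c.re * (t - t₀)) * (Real.exp (-c.re * (t - t₀)) * ‖s t‖) := by
      rw [← mul_assoc, ← Real.exp_add]
      simp
    have h2 : Real.exp (c.re * (t - t₀)) * Real.exp (a * (t - t₀)) = Real.exp (-σ * (t - t₀)) := by
      rw [← Real.exp_add, ha_def]; ring_nf
    have h3 : Real.exp (c.re * (t - t₀)) ≤ Real.exp (-σ * (t - t₀)) := by
      rw [← h2]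
      refine le_mul_of_one_le_right (Real.exp_nonneg _) (Real.one_le_exp ?_)
      exact mul_nonneg ha.le (sub_nonneg.2 ht)
    calc ‖s t‖ ≤ Real.exp (c.re * (t - t₀)) *
          (‖s t₀‖ + k / a * (Real.exp (a * (t - t₀)) - 1)) := by
          rw [h1]; gcongr
      _ = Real.exp (c.re * (t - t₀)) * ‖s t₀‖ - k / a * Real.exp (c.re * (t - t₀))
          + k / a * Real.exp (-σ * (t - t₀)) := by rw [← h2]; ring
      _ ≤ Real.exp (-σ * (t - t₀)) * ‖s t₀‖ + k / a * Real.exp (-σ * (t - t₀)) := by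
          have : 0 ≤ k / a * Real.exp (c.re * (t - t₀)) := by positivity
          have := mul_le_mul_of_nonneg_right h3 (norm_nonneg (s t₀))
          linarith
      _ = (1 + K * ‖D‖ / a) * Real.exp (-σ * (t - t₀)) * ‖s t₀‖ := by
          rw [hk]; ring

/-- Uniform exponential decay for a real matrix with eigenvalues left of `-σ`. -/
theorem EigenvaluesLeftOf.exists_norm_le {κ : Type*} [Fintype κ] [DecidableEq κ]
    {M : Matrix κ κ ℝ} {σ : ℝ} (h : EigenvaluesLeftOf M σ) :
    ∃ K : ℝ, 0 ≤ K ∧ ∀ (t₀ : ℝ) (s : ℝ → κ → ℝ), SolvesFrom t₀ s (fun t => M *ᵥ s t) →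
      ∀ t, t₀ ≤ t → ‖s t‖ ≤ K * Real.exp (-σ * (t - t₀)) * ‖s t₀‖ := by
  let A : (κ → ℂ) →L[ℂ] (κ → ℂ) := Module.End.toContinuousLinearMap _ (toC M).mulVecLin
  have hA : ∀ x, A x = toC M *ᵥ x := fun x => rfl
  set p := (toC M).charpoly with hp
  have hroots : (p.roots.map fun c => Polynomial.X - Polynomial.C c).prod = p :=
    ((IsAlgClosed.splits p).eq_prod_roots_of_monic (charpoly_monic _)).symm
  have hann : Polynomial.aeval A p = 0 := by
    have h1 := Polynomial.aeval_algHom_apply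
      ((Module.End.toContinuousLinearMap (κ → ℂ)).toAlgHom : _ →ₐ[ℂ] _) (toC M).mulVecLin p
    have h2 : Polynomial.aeval (toC M).mulVecLin p = 0 := by
      rw [hp, ← charpoly_mulVecLin]
      exact LinearMap.aeval_self_charpoly _
    rw [h2, map_zero] at h1
    exact h1
  obtain ⟨K, hK, hdec⟩ := exists_norm_le_of_aeval_prod_eq_zero A σ p.roots (fun c hc =>
    h c (mem_spectrum_iff_isRoot_charpoly.2 (Polynomial.isRoot_of_mem_roots hc)))
  refine ⟨K, hK, fun t₀ s hs t ht => ?_⟩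
  -- With the sup norm, viewing a real solution as a complex one costs no constant.
  have hnorm : ∀ x : κ → ℝ, ‖(fun i => (x i : ℂ))‖ = ‖x‖ := fun x => by
    simp [Pi.norm_def]
  have := hdec t₀ (fun t i => (s t i : ℂ)) (fun t ht => ?_) (fun t _ => by
    rw [hroots, hann]; rfl) t ht
  · simpa only [hnorm] using this
  · rw [hasDerivWithinAt_pi]
    intro i
    have h1 := (hasDerivWithinAt_pi.1 (hs t ht)) i
    have h2 := RingHom.map_mulVec (algebraMap ℝ ℂ) M (s t) i
    exact (Complex.ofRealCLM.hasFDerivAt.comp_hasDerivWithinAt t h1).congr_deriv h2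

/-- Linear systems have solutions. -/
theorem exists_hasDerivWithinAt_continuousLinearMap [NormedSpace ℝ E] [CompleteSpace E]
    (A : E →L[ℝ] E) (t₀ : ℝ) (y₀ : E) :
    ∃ y : ℝ → E, y t₀ = y₀ ∧ ∀ t, HasDerivAt y (A (y t)) t := by
  refine ⟨fun t => NormedSpace.exp ((t - t₀) • A) y₀, by simp, fun t => ?_⟩
  have h := (hasDerivAt_exp_smul_const' A (t - t₀)).scomp t ((hasDerivAt_id t).sub_const t₀)
  simpa using h.clm_apply (hasDerivAt_const t y₀)

end Decay

/-- The only possible root is `-σ - 1`; this is the polynomial assigned to reach a prescribed rate.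
-/
theorem eigenvaluesLeftOf_of_charpoly_eq {κ : Type*} [Fintype κ] [DecidableEq κ]
    {M : Matrix κ κ ℝ} {σ : ℝ} {k : ℕ}
    (h : M.charpoly = (Polynomial.X + Polynomial.C (σ + 1)) ^ k) : EigenvaluesLeftOf M σ := by
  intro z hz
  rw [mem_spectrum_iff_isRoot_charpoly, toC, charpoly_map, h, Polynomial.IsRoot] at hz
  have h1 : z + ((σ : ℂ) + 1) = 0 := by
    have : (z + ((σ : ℂ) + 1)) ^ k = 0 := by simpa using hz
    exact eq_zero_of_pow_eq_zero this
  have h2 := congrArg Complex.re h1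
  simp at h2
  linarith

theorem EigenvaluesLeftOf.fromBlocks {κ ρ : Type*} [Fintype κ] [DecidableEq κ] [Fintype ρ]
    [DecidableEq ρ] {M : Matrix κ κ ℝ} {Q : Matrix κ ρ ℝ} {N : Matrix ρ ρ ℝ} {σ : ℝ}
    (hM : EigenvaluesLeftOf M σ) (hN : EigenvaluesLeftOf N σ) :
    EigenvaluesLeftOf (Matrix.fromBlocks M Q 0 N) σ := by
  intro z hz
  rw [mem_spectrum_iff_isRoot_charpoly, toC, charpoly_map, charpoly_fromBlocks_zero₂₁,
    Polynomial.map_mul, Polynomial.IsRoot, Polynomial.eval_mul, mul_eq_zero] at hz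
  rcases hz with hz | hz
  · refine hM z (mem_spectrum_iff_isRoot_charpoly.2 ?_)
    rwa [toC, charpoly_map]
  · refine hN z (mem_spectrum_iff_isRoot_charpoly.2 ?_)
    rwa [toC, charpoly_map]

/-! ### Controller and observer design. -/

section Design

variable {ν μ π κ ρ : Type*} [Fintype ν] [Fintype μ] [Fintype κ]
  [Fintype ρ] {A : Matrix ν ν ℝ} {B : Matrix ν μ ℝ} {C : Matrix π ν ℝ} {S : Matrix κ ν ℝ}

theorem ControllerConditions.mul_genInverse_mul (h : ControllerConditions A B S)
    {G : Matrix ν κ ℝ} (hG : IsGenInverse S G) : S * A * G * S = S * A :=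
  mul_genInverse_mul_of_rank_fromRows hG h.1

/-- The matrix `(c S - S A, S B)` is `S` times `(c - A, B)`, so its left kernel contains that of
`S`; equal ranks make them equal. This is the Hautus test up to redundancy among the rows of `S`. -/
theorem ControllerConditions.vecMul_eq_zero (h : ControllerConditions A B S) {c : ℂ} {w : κ → ℂ}
    (hA : w ᵥ* toC (S * A) = c • (w ᵥ* toC S)) (hB : w ᵥ* toC (S * B) = 0) :
    w ᵥ* toC S = 0 := by
  refine vecMul_eq_zero_of_rank_eq (P := toC S)
    (Q := fromCols (c • toC S - toC (S * A)) (toC (S * B))) (fun v hv => ?_)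
    (by rw [rank_toC, h.2 c]) ?_
  · rw [vecMul_fromCols, toC_mul, toC_mul, Matrix.vecMul_sub, vecMul_smul, ← vecMul_vecMul,
      ← vecMul_vecMul, hv]
    ext i
    cases i <;> simp
  · rw [vecMul_fromCols, Matrix.vecMul_sub, vecMul_smul, hA, hB]
    ext i
    cases i <;> simp

/-- Pole placement for the dynamics of `P x`, where `S = T P` is a full rank factorization. -/
theorem ControllerConditions.exists_gain [DecidableEq ρ] (h : ControllerConditions A B S)
    {T : Matrix κ ρ ℝ} {P : Matrix ρ ν ℝ} {L : Matrix ρ κ ℝ} {R : Matrix ν ρ ℝ}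
    (hS : S = T * P) (hL : L * S = P) (hR : P * R = 1) :
    P * A = P * A * R * P ∧
    ∀ f : Polynomial ℝ, f.Monic → f.natDegree = Fintype.card ρ →
      ∃ Y : Matrix μ ρ ℝ, (P * A * R - P * B * Y).charpoly = f := by
  have hG : IsGenInverse S (R * L) := by
    calc S * (R * L) * S = S * R * (L * S) := by simp only [Matrix.mul_assoc]
      _ = T * (P * R) * P := by rw [hL, hS]; simp only [Matrix.mul_assoc]
      _ = S := by rw [hR, Matrix.mul_one, hS]
  have hPA : P * A = P * A * R * P := by
    calc P * A = L * (S * A) := by rw [← Matrix.mul_assoc, hL]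
      _ = L * (S * A * (R * L) * S) := by rw [h.mul_genInverse_mul hG]
      _ = (L * S) * A * R * (L * S) := by simp only [Matrix.mul_assoc]
      _ = P * A * R * P := by rw [hL]
  refine ⟨hPA, fun f hf hdeg => exists_charpoly_sub_mul_eq _ _ (fun c w hw hB => ?_) hf hdeg⟩
  -- A left eigenvector in the reduced coordinates is lifted through `L` to one for `S`.
  have hwS : (w ᵥ* toC L) ᵥ* toC S = w ᵥ* toC P := by rw [vecMul_vecMul, ← toC_mul, hL]
  have hz := h.vecMul_eq_zero (c := c) (w := w ᵥ* toC L) ?_ ?_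
  · rw [hwS] at hz
    have h1 : w ᵥ* toC P ᵥ* toC R = 0 := by rw [hz, zero_vecMul]
    rwa [vecMul_vecMul, ← toC_mul, hR, toC_one, vecMul_one] at h1
  · rw [toC_mul, ← vecMul_vecMul, hwS, vecMul_vecMul, ← toC_mul, hPA, toC_mul, ← vecMul_vecMul,
      hw, smul_vecMul]
  · rw [toC_mul, ← vecMul_vecMul, hwS, vecMul_vecMul, ← toC_mul, hB]

theorem HasDerivWithinAt.matrix_mulVec (M : Matrix κ ν ℝ) {x : ℝ → ν → ℝ} {x' : ν → ℝ}
    {s : Set ℝ} {t : ℝ} (hx : HasDerivWithinAt x x' s t) :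
    HasDerivWithinAt (fun t => M *ᵥ x t) (M *ᵥ x') s t :=
  (LinearMap.toContinuousLinearMap M.mulVecLin).hasFDerivAt.comp_hasDerivWithinAt t hx

variable [Fintype π]

/-- The Sylvester equation makes the observer error autonomous. -/
theorem isFunctionalObserver_of_eq {N : Matrix κ κ ℝ} {E K : Matrix κ π ℝ}
    (h : E * (C * A) + (K * C + N * S) = S * A) :
    (⟨N, K + N * E, (S - E * C) * B, E⟩ : ObserverData μ π κ).IsFunctionalObserver A B C S := by
  intro t₀ u x w hx hw t ht
  have h1 := hx t ht
  have h2 := hw t ht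
  refine ((h1.matrix_mulVec S).sub
    (h2.add ((h1.matrix_mulVec C).matrix_mulVec E))).congr_deriv ?_
  -- The choice of `H` cancels the input, and the term `N * E` in `J` completes `N w` to `N` times
  -- the estimate.
  have h3 := congrArg (· *ᵥ x t) h
  simp only [add_mulVec, ← mulVec_mulVec] at h3
  simp only [ObserverData.error, ObserverData.estimate, mulVec_add, mulVec_sub, add_mulVec,
    sub_mulVec, ← mulVec_mulVec]
  rw [← h3]
  abel

/-- Observer design with arbitrary poles. -/
theorem ObserverConditions.exists_observer [DecidableEq κ] (h : ObserverConditions A C S)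
    (B : Matrix ν μ ℝ) {g : Polynomial ℝ} (hg : g.Monic) (hdeg : g.natDegree = Fintype.card κ) :
    ∃ O : ObserverData μ π κ, O.IsFunctionalObserver A B C S ∧ O.N.charpoly = g := by
  classical
  set Q := fromRows (C * A) (fromRows C S) with hQ
  obtain ⟨G, hG⟩ := exists_isGenInverse Q
  have hSA : S * A * G * Q = S * A := mul_genInverse_mul_of_rank_fromRows hG h.1
  have hQ0 : ∀ v, toC Q *ᵥ v = 0 ↔
      toC (C * A) *ᵥ v = 0 ∧ toC C *ᵥ v = 0 ∧ toC S *ᵥ v = 0 := by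
    intro v
    rw [hQ, toC_fromRows, toC_fromRows, fromRows_mulVec, fromRows_mulVec]
    simp [funext_iff]
  -- Right multiplication by `I` extracts the last block of columns, the one that becomes `N`.
  let I : Matrix (π ⊕ (π ⊕ κ)) κ ℝ := fromRows 0 (fromRows 0 1)
  have hobs : ∀ (c : ℂ) (v : κ → ℂ), v ᵥ* toC (S * A * G * I)ᵀ = c • v →
      v ᵥ* toC ((1 - Q * G) * I)ᵀ = 0 → v = 0 := by
    intro c v h1 h2
    rw [toC_transpose, vecMul_transpose] at h1 h2
    -- The second hypothesis gives `Q ξ = I v`, that is `C A ξ = 0`, `C ξ = 0`, `S ξ = v`; the first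
    -- gives `S A ξ = c v`. So the matrix of the second observer condition kills `ξ`, its kernel is
    -- that of `Q`, and `v = S ξ = 0`.
    set ξ := toC G *ᵥ (toC I *ᵥ v) with hξ
    have h3 : toC I *ᵥ v = toC Q *ᵥ ξ := by
      rw [toC_mul, toC_sub, toC_one, toC_mul, ← mulVec_mulVec, sub_mulVec, one_mulVec,
        ← mulVec_mulVec, sub_eq_zero] at h2
      exact h2
    have hI : toC I *ᵥ v = Sum.elim (0 : π → ℂ) (Sum.elim (0 : π → ℂ) v) := by
      simp only [I]
      rw [toC_fromRows, toC_fromRows, fromRows_mulVec, fromRows_mulVec, toC_one, one_mulVec]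
      simp [toC]
    have hQξ : toC Q *ᵥ ξ
        = Sum.elim (toC (C * A) *ᵥ ξ) (Sum.elim (toC C *ᵥ ξ) (toC S *ᵥ ξ)) := by
      rw [hQ, toC_fromRows, toC_fromRows, fromRows_mulVec, fromRows_mulVec]
    rw [hI, hQξ] at h3
    have hCA : toC (C * A) *ᵥ ξ = 0 := by
      ext i; exact (congrFun h3 (Sum.inl i)).symm
    have hC : toC C *ᵥ ξ = 0 := by
      ext i; exact (congrFun h3 (Sum.inr (Sum.inl i))).symm
    have hS : toC S *ᵥ ξ = v := by
      ext i; exact (congrFun h3 (Sum.inr (Sum.inr i))).symm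
    have h4 : toC (S * A) *ᵥ ξ = c • v := by
      rw [← h1, toC_mul _ I, toC_mul _ G, ← mulVec_mulVec, ← mulVec_mulVec]
    have hker : toC Q *ᵥ ξ = 0 := by
      refine mulVec_eq_zero_of_rank_eq (P := toC Q)
        (Q := fromRows (c • toC S - toC (S * A)) (fromRows (toC (C * A)) (toC C)))
        (fun x hx => ?_) (by rw [rank_toC, h.2 c]) ?_
      · have hx' := (hQ0 x).1 hx
        have h5 : toC (S * A) *ᵥ x = 0 := by
          rw [← hSA, toC_mul, ← mulVec_mulVec, hx, mulVec_zero]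
        rw [fromRows_mulVec, fromRows_mulVec, sub_mulVec, smul_mulVec, hx'.1, hx'.2.1, hx'.2.2, h5]
        simp
      · rw [fromRows_mulVec, fromRows_mulVec, sub_mulVec, smul_mulVec, hCA, hC, hS, h4]
        simp
    rw [← hS]
    exact ((hQ0 ξ).1 hker).2.2
  obtain ⟨Y, hY⟩ := exists_charpoly_sub_mul_eq _ _ hobs hg hdeg
  -- Since `(1 - Q * G) * Q = 0`, every `Y` yields a solution of `Θ * Q = S * A`; its blocks are
  -- `(E, K, N)`.
  set Θ : Matrix κ (π ⊕ (π ⊕ κ)) ℝ := S * A * G - Yᵀ * (1 - Q * G) with hΘ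
  have hΘQ : Θ * Q = S * A := by
    rw [hΘ, Matrix.sub_mul, hSA, Matrix.mul_assoc, Matrix.sub_mul, hG, Matrix.one_mul, sub_self,
      Matrix.mul_zero, sub_zero]
  have hN : Θ.toCols₂.toCols₂ = Θ * I := by
    conv_rhs => rw [← fromCols_toCols Θ, ← fromCols_toCols Θ.toCols₂]
    simp only [I]
    rw [fromCols_mul_fromRows, fromCols_mul_fromRows]
    simp
  refine ⟨_, isFunctionalObserver_of_eq (N := Θ.toCols₂.toCols₂) (E := Θ.toCols₁)
    (K := Θ.toCols₂.toCols₁) ?_, ?_⟩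
  · rw [← hΘQ, hQ]
    conv_rhs => rw [← fromCols_toCols Θ, ← fromCols_toCols Θ.toCols₂]
    rw [fromCols_mul_fromRows, fromCols_mul_fromRows]
  · change Θ.toCols₂.toCols₂.charpoly = g
    rw [hN, ← charpoly_transpose, ← hY, hΘ, Matrix.sub_mul, Matrix.transpose_sub,
      Matrix.mul_assoc Yᵀ, Matrix.transpose_mul Yᵀ, Matrix.transpose_transpose]

end Design

/-! ### The closed loop and its decay. -/

section Loop

/-- The feedback is the nominal state feedback perturbed by the observer error. -/
theorem feedback_eq {ν μ π κ₁ κ₂ : Type*} [Fintype ν] [Fintype π] [Fintype κ₁] [Fintype κ₂]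
    [DecidableEq κ₁] {C : Matrix π ν ℝ} {S₁ : Matrix κ₁ ν ℝ} {S₂ : Matrix κ₂ ν ℝ}
    {O : ObserverData μ π (κ₁ ⊕ κ₂)} {Z : Matrix μ κ₁ ℝ} (x : ℝ → ν → ℝ) (w : ℝ → κ₁ ⊕ κ₂ → ℝ) (t : ℝ) :
    feedback O C Z x w t = -(Z *ᵥ (S₁ *ᵥ x t)) +
      (Z * fromCols (1 : Matrix κ₁ κ₁ ℝ) (0 : Matrix κ₁ κ₂ ℝ)) *ᵥ
        O.error C (fromRows S₁ S₂) x w t := by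
  have h : (fun i => O.estimate C x w t (Sum.inl i)) = S₁ *ᵥ x t -
      fromCols (1 : Matrix κ₁ κ₁ ℝ) (0 : Matrix κ₁ κ₂ ℝ) *ᵥ
        O.error C (fromRows S₁ S₂) x w t := by
    rw [fromCols_mulVec, one_mulVec, zero_mulVec, add_zero]
    ext i
    simp [ObserverData.error, fromRows_mulVec]
  rw [feedback, h, mulVec_sub, mulVec_mulVec _ Z (fromCols 1 0)]
  abel

variable {ν μ π κ₁ κ₂ ρ : Type*} [Fintype ν] [Fintype μ] [Fintype π] [Fintype κ₁] [Fintype κ₂]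
  [Fintype ρ]

theorem exists_isClosedLoop (A : Matrix ν ν ℝ) (B : Matrix ν μ ℝ) (C : Matrix π ν ℝ)
    (O : ObserverData μ π (κ₁ ⊕ κ₂)) (Z : Matrix μ κ₁ ℝ) (t₀ : ℝ) (x₀ : ν → ℝ)
    (w₀ : κ₁ ⊕ κ₂ → ℝ) : ∃ x w, IsClosedLoop A B C O Z t₀ x w ∧ x t₀ = x₀ ∧ w t₀ = w₀ := by
  let X : ((ν → ℝ) × (κ₁ ⊕ κ₂ → ℝ)) →ₗ[ℝ] (ν → ℝ) := LinearMap.fst ℝ _ _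
  let W : ((ν → ℝ) × (κ₁ ⊕ κ₂ → ℝ)) →ₗ[ℝ] (κ₁ ⊕ κ₂ → ℝ) := LinearMap.snd ℝ _ _
  let u : ((ν → ℝ) × (κ₁ ⊕ κ₂ → ℝ)) →ₗ[ℝ] (μ → ℝ) :=
    -(Z.mulVecLin ∘ₗ LinearMap.funLeft ℝ ℝ Sum.inl ∘ₗ
      (W + O.E.mulVecLin ∘ₗ C.mulVecLin ∘ₗ X))
  let D : ((ν → ℝ) × (κ₁ ⊕ κ₂ → ℝ)) →ₗ[ℝ] ((ν → ℝ) × (κ₁ ⊕ κ₂ → ℝ)) :=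
    (A.mulVecLin ∘ₗ X + B.mulVecLin ∘ₗ u).prod
      (O.N.mulVecLin ∘ₗ W + O.J.mulVecLin ∘ₗ C.mulVecLin ∘ₗ X + O.H.mulVecLin ∘ₗ u)
  obtain ⟨y, hy0, hy⟩ := exists_hasDerivWithinAt_continuousLinearMap
    (LinearMap.toContinuousLinearMap D) t₀ (x₀, w₀)
  refine ⟨fun t => (y t).1, fun t => (y t).2, ⟨fun t _ => ?_, fun t _ => ?_⟩, ?_, ?_⟩
  · have := (ContinuousLinearMap.fst ℝ (ν → ℝ) (κ₁ ⊕ κ₂ → ℝ)).hasFDerivAt.comp_hasDerivAt t (hy t)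
    exact this.hasDerivWithinAt
  · have := (ContinuousLinearMap.snd ℝ (ν → ℝ) (κ₁ ⊕ κ₂ → ℝ)).hasFDerivAt.comp_hasDerivAt t (hy t)
    exact this.hasDerivWithinAt
  · simp [hy0]
  · simp [hy0]

variable [DecidableEq κ₁] {A : Matrix ν ν ℝ} {B : Matrix ν μ ℝ} {C : Matrix π ν ℝ}
  {S₁ : Matrix κ₁ ν ℝ} {S₂ : Matrix κ₂ ν ℝ} {O : ObserverData μ π (κ₁ ⊕ κ₂)} {Z : Matrix μ κ₁ ℝ}

/-- The closed loop in the coordinates `(P x; ε)`, where `S₁ = T P` and `P A = M P`. -/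
theorem IsClosedLoop.solvesFrom (hO : O.IsFunctionalObserver A B C (fromRows S₁ S₂))
    {T : Matrix κ₁ ρ ℝ} {P : Matrix ρ ν ℝ} {M : Matrix ρ ρ ℝ} (hS : S₁ = T * P)
    (hPA : P * A = M * P) {t₀ : ℝ} {x : ℝ → ν → ℝ} {w : ℝ → κ₁ ⊕ κ₂ → ℝ}
    (h : IsClosedLoop A B C O Z t₀ x w) :
    SolvesFrom t₀ (fun t => Sum.elim (P *ᵥ x t) (O.error C (fromRows S₁ S₂) x w t))
      (fun t => fromBlocks (M - P * B * (Z * T))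
        (P * B * Z * fromCols (1 : Matrix κ₁ κ₁ ℝ) (0 : Matrix κ₁ κ₂ ℝ)) 0 O.N *ᵥ
          Sum.elim (P *ᵥ x t) (O.error C (fromRows S₁ S₂) x w t)) := by
  intro t ht
  have he := hO t₀ _ x w h.1 h.2 t ht
  have hx := (h.1 t ht).matrix_mulVec P
  rw [hasDerivWithinAt_pi]
  have hmul : ∀ (a : ρ → ℝ) (e : κ₁ ⊕ κ₂ → ℝ), fromBlocks (M - P * B * (Z * T))
      (P * B * Z * fromCols (1 : Matrix κ₁ κ₁ ℝ) (0 : Matrix κ₁ κ₂ ℝ)) 0 O.N *ᵥ Sum.elim a e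
      = Sum.elim ((M - P * B * (Z * T)) *ᵥ a +
        (P * B * Z * fromCols (1 : Matrix κ₁ κ₁ ℝ) (0 : Matrix κ₁ κ₂ ℝ)) *ᵥ e) (O.N *ᵥ e) := by
    intro a e
    rw [fromBlocks_mulVec, Sum.elim_comp_inl, Sum.elim_comp_inr, zero_mulVec, zero_add]
  rintro (i | i)
  · refine ((hasDerivWithinAt_pi.1 hx) i).congr_deriv ?_
    simp only [hmul, Sum.elim_inl]
    refine congrFun ?_ i
    have h3 : P *ᵥ (A *ᵥ x t) = M *ᵥ (P *ᵥ x t) := by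
      rw [mulVec_mulVec, hPA, ← mulVec_mulVec]
    rw [feedback_eq (S₁ := S₁) (S₂ := S₂)]
    have h4 : S₁ *ᵥ x t = T *ᵥ (P *ᵥ x t) := by rw [mulVec_mulVec, ← hS]
    rw [h4]
    simp only [mulVec_add, mulVec_neg, sub_mulVec, ← mulVec_mulVec, h3]
    abel
  · refine ((hasDerivWithinAt_pi.1 he) i).congr_deriv ?_
    simp only [hmul, Sum.elim_inr]

theorem exists_norm_mulVec_le {α β : Type*} [Fintype α] [Fintype β] (M : Matrix α β ℝ) :
    ∃ c : ℝ, 0 ≤ c ∧ ∀ v, ‖M *ᵥ v‖ ≤ c * ‖v‖ :=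
  ⟨_, norm_nonneg _, (LinearMap.toContinuousLinearMap M.mulVecLin).le_opNorm⟩

/-- The constant matrices `T` and `L` carry `(P x; ε)` and `(S₁ x; ε)` into each other, so decay in
the reduced coordinates transfers at the cost of a constant factor. -/
theorem closedLoopDecays_of_factorization [DecidableEq κ₂] [DecidableEq ρ]
    (hO : O.IsFunctionalObserver A B C (fromRows S₁ S₂))
    {T : Matrix κ₁ ρ ℝ} {P : Matrix ρ ν ℝ} {L : Matrix ρ κ₁ ℝ} {M : Matrix ρ ρ ℝ}
    (hS : S₁ = T * P) (hL : L * S₁ = P) (hPA : P * A = M * P) {σ : ℝ}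
    (hM : EigenvaluesLeftOf (M - P * B * (Z * T)) σ) (hN : EigenvaluesLeftOf O.N σ) :
    ClosedLoopDecays A B C S₁ S₂ O Z σ := by
  obtain ⟨K, hK, hdec⟩ := (hM.fromBlocks (Q := P * B * Z *
    fromCols (1 : Matrix κ₁ κ₁ ℝ) (0 : Matrix κ₁ κ₂ ℝ)) hN).exists_norm_le
  obtain ⟨c, hc, hcT⟩ := exists_norm_mulVec_le
    (fromBlocks T 0 0 1 : Matrix (κ₁ ⊕ (κ₁ ⊕ κ₂)) (ρ ⊕ (κ₁ ⊕ κ₂)) ℝ)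
  obtain ⟨d, hd, hdL⟩ := exists_norm_mulVec_le
    (fromBlocks L 0 0 1 : Matrix (ρ ⊕ (κ₁ ⊕ κ₂)) (κ₁ ⊕ (κ₁ ⊕ κ₂)) ℝ)
  refine ⟨c * K * d, fun t₀ x w h t ht => ?_⟩
  set y : ℝ → ρ ⊕ (κ₁ ⊕ κ₂) → ℝ :=
    fun t => Sum.elim (P *ᵥ x t) (O.error C (fromRows S₁ S₂) x w t) with hy
  have hT : ∀ t, closedLoopState C S₁ S₂ O x w t
      = (fromBlocks T 0 0 1 : Matrix (κ₁ ⊕ (κ₁ ⊕ κ₂)) (ρ ⊕ (κ₁ ⊕ κ₂)) ℝ) *ᵥ y t := by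
    intro t
    rw [hy, fromBlocks_mulVec, Sum.elim_comp_inl, Sum.elim_comp_inr, zero_mulVec, zero_mulVec,
      one_mulVec, add_zero, zero_add, mulVec_mulVec, ← hS]
    rfl
  have hL' : ∀ t, y t = (fromBlocks L 0 0 1 : Matrix (ρ ⊕ (κ₁ ⊕ κ₂)) (κ₁ ⊕ (κ₁ ⊕ κ₂)) ℝ) *ᵥ
      closedLoopState C S₁ S₂ O x w t := by
    intro t
    rw [closedLoopState, fromBlocks_mulVec, Sum.elim_comp_inl, Sum.elim_comp_inr, zero_mulVec,
      zero_mulVec, one_mulVec, add_zero, zero_add, mulVec_mulVec, hL]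
  calc ‖closedLoopState C S₁ S₂ O x w t‖ ≤ c * ‖y t‖ := by rw [hT]; exact hcT _
    _ ≤ c * (K * Real.exp (-σ * (t - t₀)) * ‖y t₀‖) := by
        gcongr
        exact hdec t₀ y (h.solvesFrom hO hS hPA) t ht
    _ ≤ c * (K * Real.exp (-σ * (t - t₀)) * (d * ‖closedLoopState C S₁ S₂ O x w t₀‖)) := by
        gcongr
        rw [hL' t₀]
        exact hdL _
    _ = _ := by ring

end Loop

/-! ### Assembly of the separation principle. -/

theorem theorem15 {n m p r s₁ s₂ : ℕ}
    (A : Matrix (Fin n) (Fin n) ℝ) (B : Matrix (Fin n) (Fin m) ℝ) (C : Matrix (Fin p) (Fin n) ℝ)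
    (F : Matrix (Fin r) (Fin n) ℝ) (R₁ : Matrix (Fin s₁) (Fin n) ℝ) (R₂ : Matrix (Fin s₂) (Fin n) ℝ)
    (hobs : ObserverConditions A C (fromRows (fromRows F R₁) R₂))
    (hctr : ControllerConditions A B (fromRows F R₁)) :
    -- the controller poles can be placed arbitrarily, without reference to the observer
    (LinearIndependent ℝ (fromRows F R₁).row →
      ∀ G, IsGenInverse (fromRows F R₁) G →
      ∀ f : Polynomial ℝ, f.Monic → f.natDegree = r + s₁ →
        ∃ Z : Matrix (Fin m) (Fin r ⊕ Fin s₁) ℝ,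
          (controllerBlock A B (fromRows F R₁) G Z).charpoly = f) ∧
    -- the observer poles can be placed arbitrarily, without reference to the controller
    (∀ g : Polynomial ℝ, g.Monic → g.natDegree = r + s₁ + s₂ →
      ∃ O : ObserverData (Fin m) (Fin p) ((Fin r ⊕ Fin s₁) ⊕ Fin s₂),
        O.IsFunctionalObserver A B C (fromRows (fromRows F R₁) R₂) ∧ O.N.charpoly = g) ∧
    -- the closed loop formed by any gain and any observer
    (∀ (Z : Matrix (Fin m) (Fin r ⊕ Fin s₁) ℝ)
        (O : ObserverData (Fin m) (Fin p) ((Fin r ⊕ Fin s₁) ⊕ Fin s₂)),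
      O.IsFunctionalObserver A B C (fromRows (fromRows F R₁) R₂) →
      (∀ (t₀ : ℝ) (x₀ : Fin n → ℝ) (w₀ : (Fin r ⊕ Fin s₁) ⊕ Fin s₂ → ℝ),
        ∃ x w, IsClosedLoop A B C O Z t₀ x w ∧ x t₀ = x₀ ∧ w t₀ = w₀) ∧
      ∀ G, IsGenInverse (fromRows F R₁) G →
        (∀ t₀ x w, IsClosedLoop A B C O Z t₀ x w →
          SolvesFrom t₀ (closedLoopState C (fromRows F R₁) R₂ O x w)
            (fun t => closedLoopMatrix A B (fromRows F R₁) G Z O.N *ᵥ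
              closedLoopState C (fromRows F R₁) R₂ O x w t)) ∧
        (closedLoopMatrix A B (fromRows F R₁) G Z O.N).charpoly
          = (controllerBlock A B (fromRows F R₁) G Z).charpoly * O.N.charpoly ∧
        ∀ σ : ℝ, EigenvaluesLeftOf (controllerBlock A B (fromRows F R₁) G Z) σ →
          EigenvaluesLeftOf O.N σ → ClosedLoopDecays A B C (fromRows F R₁) R₂ O Z σ) ∧
    -- every prescribed rate is attained, by a gain and an observer chosen independently
    ∀ σ : ℝ, 0 < σ →
      (∃ O : ObserverData (Fin m) (Fin p) ((Fin r ⊕ Fin s₁) ⊕ Fin s₂),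
        O.IsFunctionalObserver A B C (fromRows (fromRows F R₁) R₂) ∧ EigenvaluesLeftOf O.N σ) ∧
      ∃ Z : Matrix (Fin m) (Fin r ⊕ Fin s₁) ℝ,
        ∀ O : ObserverData (Fin m) (Fin p) ((Fin r ⊕ Fin s₁) ⊕ Fin s₂),
          O.IsFunctionalObserver A B C (fromRows (fromRows F R₁) R₂) → EigenvaluesLeftOf O.N σ →
          ClosedLoopDecays A B C (fromRows F R₁) R₂ O Z σ ∧
          ∀ t₀ x w, IsClosedLoop A B C O Z t₀ x w →
            Tendsto (fun t => F *ᵥ x t) atTop (𝓝 0) := by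
  classical
  set S₁ := fromRows F R₁ with hS₁
  have hobserver : ∀ g : Polynomial ℝ, g.Monic → g.natDegree = r + s₁ + s₂ →
      ∃ O : ObserverData (Fin m) (Fin p) ((Fin r ⊕ Fin s₁) ⊕ Fin s₂),
        O.IsFunctionalObserver A B C (fromRows S₁ R₂) ∧ O.N.charpoly = g :=
    fun g hg hdeg => hobs.exists_observer B hg (by simpa using hdeg)
  have hmonic : ∀ (σ : ℝ) (k : ℕ), ((Polynomial.X + Polynomial.C (σ + 1)) ^ k).Monic ∧
      ((Polynomial.X + Polynomial.C (σ + 1)) ^ k).natDegree = k := fun σ k =>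
    ⟨(Polynomial.monic_X_add_C _).pow k, Polynomial.natDegree_pow_X_add_C k _⟩
  refine ⟨fun hli G hG f hf hdeg => ?_, hobserver, fun Z O hO => ⟨fun t₀ x₀ w₀ =>
    exists_isClosedLoop A B C O Z t₀ x₀ w₀, fun G hG => ⟨fun t₀ x w h => ?_,
    charpoly_fromBlocks_zero₂₁ _ _ _, fun σ hc hN => ?_⟩⟩, fun σ hσ => ⟨?_, ?_⟩⟩
  -- Independent rows can be cancelled on the right, so a generalized inverse is a right inverse.
  · have hSG : S₁ * G = 1 := by
      have h1 : (S₁ * G - 1) * S₁ = 0 := by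
        rw [Matrix.sub_mul, hG, Matrix.one_mul, sub_self]
      refine sub_eq_zero.1 (Matrix.ext_of_single_vecMul fun i => ?_)
      refine (vecMul_injective_iff.2 hli) ?_
      beta_reduce
      rw [vecMul_vecMul, h1]
      simp
    exact (hctr.exists_gain (T := 1) (L := 1) (R := G) (Matrix.one_mul _).symm
      (Matrix.one_mul _) hSG).2 f hf (by simpa using hdeg)
  · have := h.solvesFrom hO (T := 1) (M := S₁ * A * G) (Matrix.one_mul _).symm
      (hctr.mul_genInverse_mul hG).symm
    rw [Matrix.mul_one] at this
    exact this
  · refine closedLoopDecays_of_factorization hO (T := 1) (L := 1) (M := S₁ * A * G)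
      (Matrix.one_mul _).symm (Matrix.one_mul _) (hctr.mul_genInverse_mul hG).symm ?_ hN
    rw [Matrix.mul_one]
    exact hc
  · obtain ⟨O, hO, hchar⟩ := hobserver _ (hmonic σ _).1 (hmonic σ _).2
    exact ⟨O, hO, eigenvaluesLeftOf_of_charpoly_eq hchar⟩
  -- With dependent rows `S₁ (A G - B Z)` is singular, so `0` is an eigenvalue of the controller
  -- block for every gain. The poles are placed for `P x` instead.
  · obtain ⟨k, T, P, L, R, -, hS, hL, hR⟩ := exists_rank_factorization S₁
    have hLS : L * S₁ = P := by rw [hS, ← Matrix.mul_assoc, hL, Matrix.one_mul]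
    obtain ⟨hPA, hgain⟩ := hctr.exists_gain hS hLS hR
    obtain ⟨Y, hY⟩ := hgain _ (hmonic σ _).1 (hmonic σ _).2
    -- Since `L * T = 1`, this gain acts on `P x` as `Y`.
    refine ⟨Y * L, fun O hO hN => ?_⟩
    have hdec : ClosedLoopDecays A B C S₁ R₂ O (Y * L) σ := by
      refine closedLoopDecays_of_factorization hO hS hLS hPA ?_ hN
      rw [Matrix.mul_assoc Y, hL, Matrix.mul_one]
      exact eigenvaluesLeftOf_of_charpoly_eq hY
    refine ⟨hdec, fun t₀ x w h => ?_⟩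
    obtain ⟨K, hK⟩ := hdec
    have hlim : Tendsto (fun t => K * Real.exp (-σ * (t - t₀)) *
        ‖closedLoopState C S₁ R₂ O x w t₀‖) atTop (𝓝 0) := by
      have h1 : Tendsto (fun t : ℝ => -σ * (t - t₀)) atTop atBot :=
        (tendsto_atTop_add_const_right atTop (-t₀) tendsto_id).const_mul_atTop_of_neg
          (neg_lt_zero.2 hσ)
      simpa using ((Real.tendsto_exp_atBot.comp h1).const_mul K).mul_const
        ‖closedLoopState C S₁ R₂ O x w t₀‖
    refine squeeze_zero_norm' ?_ hlim
    filter_upwards [eventually_ge_atTop t₀] with t ht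
    refine le_trans ?_ (hK t₀ x w h t ht)
    refine (pi_norm_le_iff_of_nonneg (norm_nonneg _)).2 fun i => ?_
    have := norm_le_pi_norm (closedLoopState C S₁ R₂ O x w t) (Sum.inl (Sum.inl i))
    simpa [closedLoopState, hS₁, fromRows_mulVec] using this
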